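/- Let $q$ be a prime power, let $H=(h_{ij})_{0\le i,j\le 3}$ be a $4\times 4$ Hermitian matrix over $\mathbb{F}_{q^2}$, that is, $H\neq 0$ and $h_{ij}=h_{ji}^{\,q}$ for all $i,j$, and suppose that $H$ has rank $3$. Let $P\mathcal{U}_2\subset\mathbb{P}^3$ be the corresponding rank $3$ Hermitian surface, the zero set of $$\sum_{i,j=0}^{3} h_{ij}\,x_i\,x_j^{\,q}$$ (a cone over a non-degenerate Hermitian curve, with vertex an $\mathbb{F}_{q^2}$-rational point $P$). Let $d\le q$, let $F\in\mathbb{F}_{q^2}[x_0,x_1,x_2,x_3]$ be a nonzero homogeneous polynomial of degree $d$, and let $V(F)\subset\mathbb{P}^3$ be its zero set. Then the number of $\mathbb{F}_{q^2}$-rational points common to $P\mathcal{U}_2$ and $V(F)$ satisfies $$\left|(P\mathcal{U}_2\cap V(F))(\mathbb{F}_{q^2})\right|\le 1+q^2\,d\,(q+1).$$ -/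

import Mathlib

open scoped LinearAlgebra.Projectivization

namespace HermitianCone

/-- The set of `K`-rational points, in projective space of dimension `n` over `K`, of the zero set
of a homogeneous polynomial `F` in `n + 1` variables with coefficients in `K`. -/
def rationalPoints {K : Type*} [Field K] {n : ℕ} (F : MvPolynomial (Fin (n + 1)) K) :
    Set (ℙ K (Fin (n + 1) → K)) :=
  {p | MvPolynomial.eval p.rep F = 0}

/-- For homogeneous `F`, membership may be tested on any homogeneous coordinates of the point. -/
theorem mk_mem_rationalPoints_iff {K : Type*} [Field K] {n d : ℕ}
    {F : MvPolynomial (Fin (n + 1)) K} (hF : F.IsHomogeneous d)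
    (v : Fin (n + 1) → K) (hv : v ≠ 0) :
    Projectivization.mk K v hv ∈ rationalPoints F ↔ MvPolynomial.eval v F = 0 := by
  obtain ⟨a, ha⟩ := Projectivization.exists_smul_eq_mk_rep K v hv
  have h : MvPolynomial.eval (a • v) F = (a : K) ^ d * MvPolynomial.eval v F := by
    rw [MvPolynomial.eval_eq', MvPolynomial.eval_eq', Finset.mul_sum]
    refine Finset.sum_congr rfl fun m hm => ?_
    have hdeg := hF (MvPolynomial.mem_support_iff.mp hm)
    have hsum : ∑ i, m i = d := by
      rw [← hdeg, Finsupp.weight_apply, Finsupp.sum_fintype _ _ (by simp)]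
      simp
    simp only [Units.smul_def, Pi.smul_apply, smul_eq_mul, mul_pow, Finset.prod_mul_distrib,
      Finset.prod_pow_eq_pow_sum, hsum]
    ring
  simp only [rationalPoints, Set.mem_ofPred_eq]
  rw [← ha, h]
  simp

/-- `H` is a Hermitian matrix over a field with `q ^ 2` elements: `H ≠ 0` and `Hᵀ = H^(q)`, where
`H^(q)` is obtained by raising every entry to the power `q`. -/
def IsHermitianMatrix {K : Type*} [Field K] {n : ℕ} (q : ℕ)
    (H : Matrix (Fin (n + 1)) (Fin (n + 1)) K) : Prop :=
  H ≠ 0 ∧ H.transpose = H.map (fun a => a ^ q)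

/-- The form `xᵀ H x^(q) = ∑ i j, h i j * x i * x j ^ q` whose zero set is the Hermitian variety
of `H`. -/
noncomputable def hermitianForm {K : Type*} [Field K] {n : ℕ} (q : ℕ)
    (H : Matrix (Fin (n + 1)) (Fin (n + 1)) K) : MvPolynomial (Fin (n + 1)) K :=
  ∑ i, ∑ j, MvPolynomial.C (H i j) * MvPolynomial.X i * MvPolynomial.X j ^ q

theorem hermitianForm_isHomogeneous {K : Type*} [Field K] {n : ℕ} (q : ℕ)
    (H : Matrix (Fin (n + 1)) (Fin (n + 1)) K) : (hermitianForm q H).IsHomogeneous (q + 1) := by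
  refine MvPolynomial.IsHomogeneous.sum _ _ _ fun i _ =>
    MvPolynomial.IsHomogeneous.sum _ _ _ fun j _ => ?_
  have h := ((MvPolynomial.isHomogeneous_C (Fin (n + 1)) (H i j)).mul
    (MvPolynomial.isHomogeneous_X K i)).mul ((MvPolynomial.isHomogeneous_X K j).pow q)
  convert h using 1
  ring

end HermitianCone

/-!
The partial derivatives of a non-degenerate Hermitian form in three variables generate the `q`-th
powers of the variables, so the curve it defines is smooth. The form is therefore irreducible: two
factors would have a common zero by Krull's height theorem, and the curve would be singular there.
By Bézout's inequality, obtained by comparing dimensions of spaces of forms, the curve meets the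
zero set of a nonzero form of degree `e ≤ q` in at most `e (q + 1)` rational points. For `e = 1`
this bounds its intersection with each of the `q ^ 2 + 1` lines through one of its points, so the
curve has at most `q * (q ^ 2 + 1) + 1 ≤ q ^ 2 (q + 1)` rational points.

Move the vertex of the cone to `(1 : 0 : 0 : 0)` and write `F` as a polynomial of degree `i` in `x₀`
whose leading coefficient `L` is a form of degree `d - i` on the base. The ruling over a point of
the curve carries at most `i` zeros of `F` besides the vertex if `L` does not vanish there, and at
most `q ^ 2` otherwise. The total is at most
`1 + i * q ^ 2 (q + 1) + q ^ 2 * (d - i) (q + 1) = 1 + q ^ 2 d (q + 1)`.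
-/

namespace HermitianCone

open MvPolynomial
open scoped Matrix

section HomogeneousFactors

variable {σ R : Type*} [CommSemiring R]

theorem le_order_coe_of_isHomogeneous {A : MvPolynomial σ R} {n : ℕ} (hA : A.IsHomogeneous n) :
    (n : ℕ∞) ≤ (A : MvPowerSeries σ R).order :=
  MvPowerSeries.nat_le_order fun m hm => by
    rw [coeff_coe]
    exact hA.coeff_eq_zero hm.ne

theorem order_coe_le_totalDegree {A : MvPolynomial σ R} (hA : A ≠ 0) :
    (A : MvPowerSeries σ R).order ≤ A.totalDegree := by
  obtain ⟨m, hm⟩ := ne_zero_iff.mp hA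
  exact (MvPowerSeries.order_le (by rwa [coeff_coe])).trans
    (Nat.cast_le.mpr (le_totalDegree (mem_support_iff.mpr hm)))

theorem isHomogeneous_totalDegree_of_le_order {A : MvPolynomial σ R}
    (hA : (A.totalDegree : ℕ∞) ≤ (A : MvPowerSeries σ R).order) :
    A.IsHomogeneous A.totalDegree := by
  intro m hm
  change Finsupp.weight (fun _ => 1) m = _
  rw [← Finsupp.degree_eq_weight_one]
  refine le_antisymm (le_totalDegree (mem_support_iff.mpr hm)) ((Nat.cast_le (α := ℕ∞)).mp ?_)
  exact hA.trans (MvPowerSeries.order_le (by rwa [coeff_coe]))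

-- The order and the total degree are both additive, and they agree on `A * B`.
theorem isHomogeneous_totalDegree_of_isHomogeneous_mul [IsDomain R] {A B : MvPolynomial σ R} {n : ℕ}
    (hA : A ≠ 0) (hB : B ≠ 0) (h : (A * B).IsHomogeneous n) :
    A.IsHomogeneous A.totalDegree := by
  have horder := le_order_coe_of_isHomogeneous h
  rw [coe_mul, MvPowerSeries.order_mul, ← h.totalDegree (mul_ne_zero hA hB),
    totalDegree_mul_of_isDomain hA hB, Nat.cast_add] at horder
  refine isHomogeneous_totalDegree_of_le_order ?_
  exact (ENat.add_le_add_iff_right (ENat.natCast_ne_top _)).mp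
    (horder.trans (add_le_add_right (order_coe_le_totalDegree hB) _))

theorem isHomogeneous_of_isHomogeneous_mul_left [IsDomain R] {A B : MvPolynomial σ R} {m n : ℕ}
    (hA : A.IsHomogeneous m) (hA0 : A ≠ 0) (h : (A * B).IsHomogeneous (m + n)) :
    B.IsHomogeneous n := by
  rcases eq_or_ne B 0 with rfl | hB0
  · exact isHomogeneous_zero σ R n
  have hdeg := h.totalDegree (mul_ne_zero hA0 hB0)
  rw [totalDegree_mul_of_isDomain hA0 hB0, hA.totalDegree hA0] at hdeg
  rw [mul_comm] at h
  exact Nat.add_left_cancel hdeg ▸ isHomogeneous_totalDegree_of_isHomogeneous_mul hB0 hA0 h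

end HomogeneousFactors

section SmoothHypersurface

theorem card_le_height_of_X_mem {σ R : Type*} [CommRing R] [IsDomain R] (s : Finset σ)
    (P : Ideal (MvPolynomial σ R)) [P.IsPrime] (hP : ∀ i ∈ s, X i ∈ P) :
    (s.card : ℕ∞) ≤ P.height := by
  classical
  induction s using Finset.induction generalizing P with
  | empty => simp
  | insert i s hi ih =>
    let killVars : MvPolynomial σ R →ₐ[R] MvPolynomial σ R :=
      aeval fun j => if j ∈ s then 0 else X j
    have hle : RingHom.ker killVars ≤ P := fun f hf => by
      have hmk : (Ideal.Quotient.mkₐ R P).comp killVars = Ideal.Quotient.mkₐ R P := by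
        ext j
        by_cases hj : j ∈ s
        · simp [killVars, hj, (Ideal.Quotient.eq_zero_iff_mem.mpr
            (hP j (Finset.mem_insert_of_mem hj))).symm]
        · simp [killVars, hj]
      rw [← Ideal.Quotient.eq_zero_iff_mem, ← Ideal.Quotient.mkₐ_eq_mk R, ← hmk,
        AlgHom.comp_apply, (RingHom.mem_ker).mp hf, map_zero]
    have : (RingHom.ker killVars).IsPrime := RingHom.ker_isPrime killVars
    have hlt : RingHom.ker killVars < P :=
      SetLike.lt_iff_le_and_exists.mpr
        ⟨hle, X i, hP i (Finset.mem_insert_self i s), by simp [killVars, hi, RingHom.mem_ker]⟩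
    have hs := ih (RingHom.ker killVars) fun j hj => by simp [killVars, hj, RingHom.mem_ker]
    rw [Finset.card_insert_of_notMem hi, Nat.cast_add, Nat.cast_one]
    exact (add_le_add_left hs 1).trans (Ideal.height_add_one_le_of_lt_of_isPrime hlt)

variable {σ K : Type*} [Field K]

theorem constantCoeff_eq_zero_of_isHomogeneous {A : MvPolynomial σ K} {n : ℕ}
    (hA : A.IsHomogeneous n) (hunit : ¬ IsUnit A) : constantCoeff A = 0 := by
  rcases eq_or_ne n 0 with rfl | hn
  · rw [← totalDegree_zero_iff_isHomogeneous, totalDegree_eq_zero_iff_eq_C] at hA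
    by_contra hne
    exact hunit (hA ▸ (isUnit_iff_ne_zero.mpr hne).map C)
  · rw [constantCoeff_eq]
    exact hA.coeff_eq_zero (by simpa using hn.symm)

theorem isUnit_or_isUnit_of_X_mem_radical_span_pair [Fintype σ] (hσ : 2 < Fintype.card σ)
    {D E : MvPolynomial σ K} {m n : ℕ} (hD : D.IsHomogeneous m) (hE : E.IsHomogeneous n)
    (hX : ∀ j, X j ∈ (Ideal.span {D, E}).radical) : IsUnit D ∨ IsUnit E := by
  by_contra! hunit
  have horigin : Ideal.span {D, E} ≤ RingHom.ker (constantCoeff (σ := σ) (R := K)) := by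
    rw [Ideal.span_le, Set.pair_subset_iff]
    exact ⟨constantCoeff_eq_zero_of_isHomogeneous hD hunit.1,
      constantCoeff_eq_zero_of_isHomogeneous hE hunit.2⟩
  have := RingHom.ker_isPrime (constantCoeff (σ := σ) (R := K))
  obtain ⟨P, hP, -⟩ := Ideal.exists_minimalPrimes_le horigin
  have := hP.1.1
  have hlower := card_le_height_of_X_mem Finset.univ P fun j _ =>
    this.radical_le_iff.mpr hP.1.2 (hX j)
  have hupper := Ideal.height_le_card_of_mem_minimalPrimes_span (Set.toFinite {D, E}) hP
  have hcard := (Nat.cast_le (α := ℕ∞)).mp (hlower.trans hupper)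
  have hpair : ({D, E} : Set (MvPolynomial σ K)).ncard ≤ 2 :=
    (Set.ncard_insert_le D {E}).trans (by rw [Set.ncard_singleton])
  exact absurd (hcard.trans hpair) (by simpa using hσ)

theorem irreducible_of_X_mem_radical_span_pderiv [Fintype σ] (hσ : 2 < Fintype.card σ)
    {h : MvPolynomial σ K} {n : ℕ} (hh : h.IsHomogeneous n)
    (hsmooth : ∀ j, X j ∈ (Ideal.span (Set.range fun i => pderiv i h)).radical) :
    Irreducible h := by
  obtain ⟨j₀⟩ : Nonempty σ := Fintype.card_pos_iff.mp (by omega)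
  have hconst (a : K) : h ≠ C a := by
    rintro rfl
    have hspan : Ideal.span (Set.range fun i => pderiv i (C a : MvPolynomial σ K)) = ⊥ :=
      Ideal.span_eq_bot.mpr (by rintro _ ⟨i, rfl⟩; exact pderiv_C)
    have hX := hsmooth j₀
    rw [hspan, Ideal.radical_bot_of_isReduced, Ideal.mem_bot] at hX
    exact X_ne_zero j₀ hX
  have h0 : h ≠ 0 := by simpa using hconst 0
  refine ⟨fun hu => ?_, fun D E hDE => ?_⟩
  · obtain ⟨a, -, ha⟩ := isUnit_iff_eq_C_of_isReduced.mp hu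
    exact hconst a ha
  subst hDE
  have hD0 := left_ne_zero_of_mul h0
  have hE0 := right_ne_zero_of_mul h0
  have hsing : Ideal.span (Set.range fun i => pderiv i (D * E)) ≤ Ideal.span {D, E} := by
    rw [Ideal.span_le]
    rintro _ ⟨i, rfl⟩
    exact Ideal.mem_span_pair.mpr ⟨pderiv i E, pderiv i D, by simp only [pderiv_mul]; ring⟩
  exact isUnit_or_isUnit_of_X_mem_radical_span_pair hσ
    (isHomogeneous_totalDegree_of_isHomogeneous_mul hD0 hE0 hh)
    (isHomogeneous_totalDegree_of_isHomogeneous_mul hE0 hD0 (mul_comm D E ▸ hh))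
    fun j => Ideal.radical_mono hsing (hsmooth j)

end SmoothHypersurface

section Hermitian

variable {K : Type*} [Field K] {n q : ℕ}

theorem eval_hermitianForm (H : Matrix (Fin (n + 1)) (Fin (n + 1)) K) (v : Fin (n + 1) → K) :
    eval v (hermitianForm q H) = v ⬝ᵥ H *ᵥ fun j => v j ^ q := by
  simp only [hermitianForm, map_sum, map_mul, eval_C, eval_X, map_pow, dotProduct, Matrix.mulVec,
    Finset.mul_sum, mul_left_comm, mul_assoc]

theorem pderiv_hermitianForm (hq : (q : K) = 0) (M : Matrix (Fin (n + 1)) (Fin (n + 1)) K)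
    (k : Fin (n + 1)) : pderiv k (hermitianForm q M) = ∑ j, C (M k j) * X j ^ q := by
  have hq' : (q : MvPolynomial (Fin (n + 1)) K) = 0 := by
    rw [← map_natCast C, hq, map_zero]
  simp [hermitianForm, hq', pderiv_X, Pi.single_apply, mul_comm]

theorem X_pow_eq_sum_pderiv_hermitianForm (hq : (q : K) = 0)
    {M : Matrix (Fin (n + 1)) (Fin (n + 1)) K} (hM : M.det ≠ 0) (j : Fin (n + 1)) :
    (X j ^ q : MvPolynomial (Fin (n + 1)) K) =
      ∑ i, C (M⁻¹ j i) * pderiv i (hermitianForm q M) := by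
  have hinv : M⁻¹ * M = 1 := Matrix.nonsing_inv_mul _ (isUnit_iff_ne_zero.mpr hM)
  simp only [pderiv_hermitianForm hq, Finset.mul_sum, ← mul_assoc, ← C_mul]
  rw [Finset.sum_comm]
  simp only [← Finset.sum_mul, ← map_sum, ← Matrix.mul_apply, hinv]
  simp [Matrix.one_apply]

theorem irreducible_hermitianForm (hn : 2 ≤ n) (hq : (q : K) = 0)
    {M : Matrix (Fin (n + 1)) (Fin (n + 1)) K} (hM : M.det ≠ 0) :
    Irreducible (hermitianForm q M) := by
  refine irreducible_of_X_mem_radical_span_pderiv (by simpa using by omega)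
    (hermitianForm_isHomogeneous q M) fun j => ⟨q, ?_⟩
  rw [X_pow_eq_sum_pderiv_hermitianForm hq hM]
  exact Ideal.sum_mem _ fun i _ =>
    Ideal.mul_mem_left _ _ (Ideal.subset_span (Set.mem_range_self i))

end Hermitian

section LinearForms

variable {K σ : Type*} [Field K] [Fintype σ] [DecidableEq σ]

/-- The polynomial of degree one inducing the linear functional `ℓ` on `σ → K`. -/
noncomputable def linearForm (ℓ : Module.Dual K (σ → K)) : MvPolynomial σ K :=
  ∑ i, C (ℓ (Pi.single i 1)) * X i

theorem linearForm_isHomogeneous (ℓ : Module.Dual K (σ → K)) : (linearForm ℓ).IsHomogeneous 1 :=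
  IsHomogeneous.sum _ _ _ fun _ _ => isHomogeneous_C_mul_X _ _

@[simp]
theorem eval_linearForm (ℓ : Module.Dual K (σ → K)) (v : σ → K) :
    eval v (linearForm ℓ) = ℓ v := by
  conv_rhs => rw [pi_eq_sum_univ' v, map_sum]
  simp [linearForm, mul_comm]

theorem linearForm_ne_zero {ℓ : Module.Dual K (σ → K)} (hℓ : ℓ ≠ 0) : linearForm ℓ ≠ 0 := by
  contrapose! hℓ
  refine LinearMap.ext fun v => ?_
  rw [← eval_linearForm, hℓ, map_zero, LinearMap.zero_apply]

end LinearForms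

section Separation

variable {K V : Type*} [Field K] [AddCommGroup V] [Module K V]

theorem exists_dual_rep_ne_zero (x : ℙ K V) : ∃ ℓ : Module.Dual K V, ℓ x.rep ≠ 0 :=
  Module.Projective.exists_dual_ne_zero K x.rep_nonzero

theorem exists_dual_separating {x y : ℙ K V} (h : x ≠ y) :
    ∃ ℓ : Module.Dual K V, ℓ x.rep ≠ 0 ∧ ℓ y.rep = 0 := by
  have hspan : x.rep ∉ Submodule.span K {y.rep} := by
    rwa [Submodule.mem_span_singleton,
      ← Projectivization.mk_eq_mk_iff' K _ _ x.rep_nonzero y.rep_nonzero,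
      Projectivization.mk_rep, Projectivization.mk_rep]
  obtain ⟨ℓ, hℓx, hℓy⟩ := Submodule.exists_le_ker_of_notMem hspan
  exact ⟨ℓ, hℓx, hℓy (Submodule.mem_span_singleton_self _)⟩

-- A product of `Z.card` linear forms missing `z`, each of which vanishes at another point of `Z`.
theorem exists_form_separating {n t : ℕ} {Z : Finset (ℙ K (Fin n → K))} (ht : Z.card ≤ t)
    (z : ℙ K (Fin n → K)) :
    ∃ P : MvPolynomial (Fin n) K, P.IsHomogeneous t ∧ eval z.rep P = 1 ∧
      ∀ y ∈ Z, y ≠ z → eval y.rep P = 0 := by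
  obtain ⟨ℓ₀, hℓ₀⟩ := exists_dual_rep_ne_zero z
  have hℓ (y : ℙ K (Fin n → K)) :
      ∃ ℓ : Module.Dual K (Fin n → K), ℓ z.rep ≠ 0 ∧ (y ≠ z → ℓ y.rep = 0) := by
    rcases eq_or_ne y z with rfl | hyz
    · exact ⟨ℓ₀, hℓ₀, fun h => absurd rfl h⟩
    · obtain ⟨ℓ, hℓz, hℓy⟩ := exists_dual_separating hyz.symm
      exact ⟨ℓ, hℓz, fun _ => hℓy⟩
  choose ℓ hℓz hℓy using hℓ
  set Q : MvPolynomial (Fin n) K := (∏ y ∈ Z, linearForm (ℓ y)) * linearForm ℓ₀ ^ (t - Z.card)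
  have hQ : Q.IsHomogeneous t := by
    have hprod := IsHomogeneous.prod Z (fun y => linearForm (ℓ y)) (fun _ => 1)
      fun y _ => linearForm_isHomogeneous (ℓ y)
    have hmul := hprod.mul ((linearForm_isHomogeneous ℓ₀).pow (t - Z.card))
    rwa [Finset.sum_const, smul_eq_mul, mul_one, one_mul, Nat.add_sub_cancel' ht] at hmul
  have hQ_eval (v : Fin n → K) : eval v Q = (∏ y ∈ Z, ℓ y v) * ℓ₀ v ^ (t - Z.card) := by
    simp [Q, map_prod]
  have hQz : eval z.rep Q ≠ 0 := by
    rw [hQ_eval]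
    exact mul_ne_zero (Finset.prod_ne_zero_iff.mpr fun y _ => hℓz y) (pow_ne_zero _ hℓ₀)
  refine ⟨C (eval z.rep Q)⁻¹ * Q, hQ.C_mul _, by simp [hQz], fun y hy hyz => ?_⟩
  rw [map_mul, hQ_eval y.rep, Finset.prod_eq_zero hy (hℓy y hyz), zero_mul, mul_zero]

/-- Evaluation of forms of degree `t` at the chosen representatives of the points of `Z`. -/
noncomputable def evalPoints {n : ℕ} (t : ℕ) (Z : Finset (ℙ K (Fin n → K))) :
    homogeneousSubmodule (Fin n) K t →ₗ[K] (Z → K) :=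
  LinearMap.pi fun z => (aeval (R := K) z.1.rep).toLinearMap ∘ₗ Submodule.subtype _

@[simp]
theorem evalPoints_apply {n t : ℕ} (Z : Finset (ℙ K (Fin n → K)))
    (P : homogeneousSubmodule (Fin n) K t) (z : Z) :
    evalPoints t Z P z = eval z.1.rep P.1 := by
  simp [evalPoints, aeval_eq_eval]

theorem evalPoints_surjective {n t : ℕ} {Z : Finset (ℙ K (Fin n → K))} (ht : Z.card ≤ t) :
    Function.Surjective (evalPoints t Z) := by
  intro f
  choose P hP hP1 hP0 using exists_form_separating ht
  refine ⟨∑ z : Z, f z • ⟨P z, hP z⟩, funext fun y => ?_⟩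
  rw [map_sum, Finset.sum_apply, Finset.sum_eq_single y]
  · simp [hP1]
  · intro z _ hzy
    simp [hP0 z.1 y.1 y.2 fun h => hzy (Subtype.ext h.symm)]
  · simp

end Separation

section FormMultiples

/-- The space `D * S_n` of multiples of `D` by forms of degree `n`. -/
noncomputable def formMultiples {σ K : Type*} [Field K] (D : MvPolynomial σ K) (n : ℕ) :
    Submodule K (MvPolynomial σ K) :=
  (homogeneousSubmodule σ K n).map (LinearMap.mulLeft K D)

variable {σ K : Type*} [Field K] {D E : MvPolynomial σ K}

theorem mem_formMultiples {P : MvPolynomial σ K} {n : ℕ} :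
    P ∈ formMultiples D n ↔ ∃ A : MvPolynomial σ K, A.IsHomogeneous n ∧ D * A = P := by
  simp [formMultiples]

theorem finrank_formMultiples (hD : D ≠ 0) (n : ℕ) :
    Module.finrank K (formMultiples D n) = Module.finrank K (homogeneousSubmodule σ K n) :=
  (LinearEquiv.finrank_eq (Submodule.equivMapOfInjective (LinearMap.mulLeft K D)
    (mul_right_injective₀ hD) _)).symm

theorem formMultiples_le {r : ℕ} (hD : D.IsHomogeneous r) (n : ℕ) :
    formMultiples D n ≤ homogeneousSubmodule σ K (r + n) := by
  intro P hP
  obtain ⟨A, hA, rfl⟩ := mem_formMultiples.mp hP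
  exact hD.mul hA

theorem formMultiples_inf_le {s : ℕ} (hE : E.IsHomogeneous s) (hE0 : E ≠ 0)
    (hDE : IsRelPrime D E) (b c : ℕ) :
    formMultiples D (s + c) ⊓ formMultiples E b ≤ formMultiples (D * E) c := by
  rintro P ⟨hPD, hPE⟩
  obtain ⟨A, hA, rfl⟩ := mem_formMultiples.mp hPD
  obtain ⟨B, -, hB⟩ := mem_formMultiples.mp hPE
  obtain ⟨Q, rfl⟩ := hDE.symm.dvd_of_dvd_mul_left (Dvd.intro B hB)
  exact mem_formMultiples.mpr ⟨Q, isHomogeneous_of_isHomogeneous_mul_left hE hE0 hA, by ring⟩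

variable [Finite σ]

instance finite_homogeneousSubmodule (n : ℕ) : Module.Finite K (homogeneousSubmodule σ K n) :=
  Module.Finite.iff_fg.mpr (homogeneousSubmodule_fg σ K n)

instance finite_formMultiples (n : ℕ) : Module.Finite K (formMultiples D n) :=
  inferInstanceAs (Module.Finite K ((homogeneousSubmodule σ K n).map _))

theorem finrank_add_finrank_le_finrank_sup_formMultiples {r s : ℕ} (hE : E.IsHomogeneous s)
    (hD0 : D ≠ 0) (hE0 : E ≠ 0) (hDE : IsRelPrime D E) (c : ℕ) :
    Module.finrank K (homogeneousSubmodule σ K (s + c)) +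
        Module.finrank K (homogeneousSubmodule σ K (r + c)) ≤
      Module.finrank K ↥(formMultiples D (s + c) ⊔ formMultiples E (r + c)) +
        Module.finrank K (homogeneousSubmodule σ K c) := by
  rw [← finrank_formMultiples hD0 (s + c), ← finrank_formMultiples hE0 (r + c),
    ← finrank_formMultiples (mul_ne_zero hD0 hE0) c, ← Submodule.finrank_sup_add_finrank_inf_eq]
  gcongr
  exact Submodule.finrank_mono (formMultiples_inf_le hE hE0 hDE (r + c) c)

end FormMultiples

section Bezout

variable {K : Type*} [Field K]

theorem finrank_homogeneousSubmodule {σ : Type*} [Fintype σ] (n : ℕ) :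
    Module.finrank K (homogeneousSubmodule σ K n) = (Fintype.card σ + n - 1).choose n := by
  classical
  have hset : {d : σ →₀ ℕ | d.degree = n} =
      (Finset.finsuppAntidiag (Finset.univ : Finset σ) n : Set (σ →₀ ℕ)) := by
    ext d
    simp [Finsupp.degree_eq_sum]
  have hsupp := homogeneousSubmodule_eq_finsupp_supported σ K n
  rw [hset] at hsupp
  rw [LinearEquiv.finrank_eq ((LinearEquiv.ofEq _ _ hsupp).trans
    (AddMonoidAlgebra.supportedEquivFinsupp (R := K) _)), Module.finrank_finsupp_self,
    ← Nat.card_eq_fintype_card, Nat.card_eq_card_toFinset]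
  simp only [Finset.toFinset_coe, Finset.card_finsuppAntidiag_nat_eq_choose, Finset.card_univ]

theorem finrank_homogeneousSubmodule_fin_three (n : ℕ) :
    Module.finrank K (homogeneousSubmodule (Fin 3) K n) = (n + 2).choose 2 := by
  rw [finrank_homogeneousSubmodule, Fintype.card_fin, show 3 + n - 1 = n + 2 by omega,
    Nat.choose_symm_add]

theorem choose_two_add_mul (r s c : ℕ) :
    (c + 2).choose 2 + (r + (s + c) + 2).choose 2 =
      (s + c + 2).choose 2 + (r + c + 2).choose 2 + r * s := by
  have h (n : ℕ) : 2 * (n + 2).choose 2 = (n + 2) * (n + 1) := by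
    rw [Nat.choose_two_right, Nat.mul_div_cancel' (Nat.even_mul_pred_self _).two_dvd]
    rfl
  linarith [h c, h (r + (s + c)), h (s + c), h (r + c)]

theorem sup_formMultiples_le_map_ker_evalPoints {n r s c : ℕ} {D E : MvPolynomial (Fin n) K}
    (hD : D.IsHomogeneous r) (hE : E.IsHomogeneous s) {Z : Finset (ℙ K (Fin n → K))}
    (hZ : ∀ z ∈ Z, eval z.rep D = 0 ∧ eval z.rep E = 0) :
    formMultiples D (s + c) ⊔ formMultiples E (r + c) ≤
      (LinearMap.ker (evalPoints (r + (s + c)) Z)).map (Submodule.subtype _) := by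
  have hEle := formMultiples_le hE (r + c)
  rw [add_left_comm] at hEle
  refine sup_le (fun P hP => ⟨⟨P, formMultiples_le hD _ hP⟩, ?_, rfl⟩)
    (fun P hP => ⟨⟨P, hEle hP⟩, ?_, rfl⟩)
  all_goals
    obtain ⟨A, -, rfl⟩ := mem_formMultiples.mp hP
    refine LinearMap.mem_ker.mpr (funext fun z => ?_)
    simp [hZ z.1 z.2]

theorem card_le_mul_of_isRelPrime {D E : MvPolynomial (Fin 3) K} {r s : ℕ}
    (hD : D.IsHomogeneous r) (hE : E.IsHomogeneous s) (hD0 : D ≠ 0) (hE0 : E ≠ 0)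
    (hDE : IsRelPrime D E) {Z : Finset (ℙ K (Fin 3 → K))}
    (hZ : ∀ z ∈ Z, eval z.rep D = 0 ∧ eval z.rep E = 0) : Z.card ≤ r * s := by
  set c := Z.card with hc
  have hsurj := evalPoints_surjective (t := r + (s + c)) (Z := Z) (by omega)
  have hrank := LinearMap.finrank_range_add_finrank_ker (evalPoints (r + (s + c)) Z)
  rw [LinearMap.range_eq_top.mpr hsurj, finrank_top, finrank_homogeneousSubmodule_fin_three,
    Module.finrank_fintype_fun_eq_card, Fintype.card_coe, ← hc] at hrank
  have hker := Submodule.finrank_mono (sup_formMultiples_le_map_ker_evalPoints (c := c) hD hE hZ)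
  rw [Submodule.finrank_map_subtype_eq] at hker
  have hsup := finrank_add_finrank_le_finrank_sup_formMultiples (r := r) hE hD0 hE0 hDE c
  simp only [finrank_homogeneousSubmodule_fin_three] at hsup
  have hchoose := choose_two_add_mul r s c
  omega

theorem encard_rationalPoints_inter_le {D E : MvPolynomial (Fin (2 + 1)) K} {r s : ℕ}
    (hD : D.IsHomogeneous r) (hE : E.IsHomogeneous s) (hD0 : D ≠ 0) (hE0 : E ≠ 0)
    (hDE : IsRelPrime D E) : (rationalPoints D ∩ rationalPoints E).encard ≤ (r * s : ℕ) := by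
  by_contra! hlt
  obtain ⟨Z, hZsub, hZcard⟩ := Set.exists_subset_encard_eq (Order.add_one_le_of_lt hlt)
  have hfin : Z.Finite := Set.finite_of_encard_eq_coe (k := r * s + 1) (by exact_mod_cast hZcard)
  have hle := card_le_mul_of_isRelPrime hD hE hD0 hE0 hDE (Z := hfin.toFinset)
    fun z hz => hZsub (hfin.mem_toFinset.mp hz)
  rw [hfin.encard_eq_coe_toFinset_card] at hZcard
  have : hfin.toFinset.card = r * s + 1 := by exact_mod_cast hZcard
  omega

end Bezout

section PlaneCurves

variable {K : Type*} [Field K]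

theorem ncard_hermitian_inter_le {q e : ℕ} (hq : (q : K) = 0)
    {M : Matrix (Fin (2 + 1)) (Fin (2 + 1)) K} (hM : M.det ≠ 0)
    {G : MvPolynomial (Fin (2 + 1)) K} (hG : G.IsHomogeneous e) (hG0 : G ≠ 0) (he : e ≤ q) :
    (rationalPoints (hermitianForm q M) ∩ rationalPoints G).ncard ≤ e * (q + 1) := by
  have hirr := irreducible_hermitianForm le_rfl hq hM
  have hndvd : ¬ hermitianForm q M ∣ G := fun hdvd => by
    have hle := totalDegree_le_of_dvd_of_isDomain hdvd hG0
    rw [(hermitianForm_isHomogeneous q M).totalDegree hirr.ne_zero, hG.totalDegree hG0] at hle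
    omega
  rw [mul_comm]
  exact ENat.toNat_le_of_le_natCast (encard_rationalPoints_inter_le
    (hermitianForm_isHomogeneous q M) hG hirr.ne_zero hG0 (hirr.isRelPrime_iff_not_dvd.mpr hndvd))

end PlaneCurves

section Pencil

variable {K V : Type*} [Field K] [AddCommGroup V] [Module K V]

theorem exists_ne_zero_apply_eq_zero (hV : 1 < Module.finrank K V) (f : V →ₗ[K] K) :
    ∃ v ≠ 0, f v = 0 := by
  have : Module.Finite K V := Module.finite_of_finrank_pos (by omega)
  obtain ⟨v, hv, hv0⟩ := Submodule.exists_mem_ne_zero_of_ne_bot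
    (LinearMap.ker_ne_bot_of_finrank_lt (f := f) (by rwa [Module.finrank_self]))
  exact ⟨v, hv0, hv⟩

theorem finrank_dual_quotient_span_rep (hV : Module.finrank K V = 3) (u : ℙ K V) :
    Module.finrank K (Module.Dual K (V ⧸ Submodule.span K {u.rep})) = 2 := by
  have : Module.Finite K V := Module.finite_of_finrank_pos (by omega)
  have h := (Submodule.span K {u.rep}).finrank_quotient_add_finrank
  rw [finrank_span_singleton u.rep_nonzero, hV] at h
  rw [Subspace.dual_finrank_eq]
  omega

/-- The trace on `S` of the line of the plane `ℙ K V` defined by `p`. The lines through a point `u`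
are thus encoded as the points of the projectivization of the functionals vanishing at `u`. -/
def pencilLine (S : Set (ℙ K V)) {u : ℙ K V}
    (p : ℙ K (Module.Dual K (V ⧸ Submodule.span K {u.rep}))) : Set (ℙ K V) :=
  {z ∈ S | (p.rep ∘ₗ Submodule.mkQ _) z.rep = 0}

theorem exists_mem_pencilLine (hV : Module.finrank K V = 3) {S : Set (ℙ K V)} {z : ℙ K V}
    (hz : z ∈ S) (u : ℙ K V) :
    ∃ p : ℙ K (Module.Dual K (V ⧸ Submodule.span K {u.rep})), z ∈ pencilLine S p := by
  obtain ⟨ℓ, hℓ, hℓz⟩ := exists_ne_zero_apply_eq_zero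
    (by rw [finrank_dual_quotient_span_rep hV u]; exact one_lt_two)
    (Module.Dual.eval K (V ⧸ Submodule.span K {u.rep}) (Submodule.mkQ _ z.rep))
  obtain ⟨a, ha⟩ := Projectivization.exists_smul_eq_mk_rep K ℓ hℓ
  refine ⟨Projectivization.mk K ℓ hℓ, hz, ?_⟩
  rw [Module.Dual.eval_apply] at hℓz
  rw [LinearMap.comp_apply, ← ha, LinearMap.smul_apply, hℓz, smul_zero]

theorem mem_pencilLine_self {S : Set (ℙ K V)} {u : ℙ K V} (hu : u ∈ S)
    (p : ℙ K (Module.Dual K (V ⧸ Submodule.span K {u.rep}))) : u ∈ pencilLine S p := by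
  refine ⟨hu, ?_⟩
  rw [LinearMap.comp_apply, Submodule.mkQ_apply,
    (Submodule.Quotient.mk_eq_zero _).mpr (Submodule.mem_span_singleton_self u.rep), map_zero]

-- The plane is covered by the `Nat.card K + 1` lines through a point of `S`.
theorem ncard_le_of_forall_line [Finite K] (hV : Module.finrank K V = 3) {S : Set (ℙ K V)} {m : ℕ}
    (hS : ∀ ℓ : Module.Dual K V, ℓ ≠ 0 → {z ∈ S | ℓ z.rep = 0}.ncard ≤ m + 1) :
    S.ncard ≤ m * (Nat.card K + 1) + 1 := by
  have : Module.Finite K V := Module.finite_of_finrank_pos (by omega)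
  have : Finite V := Module.finite_of_finite K
  obtain rfl | ⟨u, hu⟩ := S.eq_empty_or_nonempty
  · simp
  set U := Submodule.span K {u.rep}
  have hcover : S ⊆ insert u (⋃ p : ℙ K (Module.Dual K (V ⧸ U)), pencilLine S p \ {u}) := by
    intro z hz
    obtain ⟨p, hp⟩ := exists_mem_pencilLine hV hz u
    exact or_iff_not_imp_left.mpr fun hzu => Set.mem_iUnion.mpr ⟨p, hp, hzu⟩
  have hline (p : ℙ K (Module.Dual K (V ⧸ U))) : (pencilLine S p \ {u}).ncard ≤ m := by
    rw [Set.ncard_sdiff_singleton_of_mem (mem_pencilLine_self hu p)]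
    exact Nat.sub_le_of_le_add (hS _ fun h =>
      p.rep_nonzero ((LinearMap.cancel_right U.mkQ_surjective).mp h))
  have : Finite (Module.Dual K (V ⧸ U)) := Module.finite_of_finite K
  have := Fintype.ofFinite (ℙ K (Module.Dual K (V ⧸ U)))
  calc S.ncard ≤ (⋃ p : ℙ K (Module.Dual K (V ⧸ U)), pencilLine S p \ {u}).ncard + 1 :=
        (Set.ncard_le_ncard hcover (Set.toFinite _)).trans (Set.ncard_insert_le _ _)
    _ ≤ (∑ _ : ℙ K (Module.Dual K (V ⧸ U)), m) + 1 := by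
        gcongr
        exact (Set.ncard_iUnion_le_of_fintype _).trans (Finset.sum_le_sum fun p _ => hline p)
    _ = m * (Nat.card K + 1) + 1 := by
        rw [Finset.sum_const, Finset.card_univ, ← Nat.card_eq_fintype_card,
          Projectivization.card_of_finrank_two K _ (finrank_dual_quotient_span_rep hV u),
          smul_eq_mul, mul_comm]

end Pencil

section HermitianCurve

variable {K : Type*} [Field K] [Finite K] {q : ℕ}

theorem ncard_hermitian_curve_le (hK : Nat.card K = q ^ 2) (hq : (q : K) = 0)
    {M : Matrix (Fin (2 + 1)) (Fin (2 + 1)) K} (hM : M.det ≠ 0) :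
    (rationalPoints (hermitianForm q M)).ncard ≤ q ^ 2 * (q + 1) := by
  have hq2 : 1 < q := (one_lt_pow_iff two_ne_zero).mp (hK ▸ Finite.one_lt_card)
  have hline (ℓ : Module.Dual K (Fin (2 + 1) → K)) (hℓ : ℓ ≠ 0) :
      {z ∈ rationalPoints (hermitianForm q M) | ℓ z.rep = 0}.ncard ≤ q + 1 := by
    have h := ncard_hermitian_inter_le hq hM (linearForm_isHomogeneous ℓ) (linearForm_ne_zero hℓ)
      hq2.le
    rw [one_mul] at h
    convert h using 2
    ext z
    simp [rationalPoints]
  refine (ncard_le_of_forall_line (by simp) hline).trans ?_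
  rw [hK]
  nlinarith

end HermitianCurve

section Cone

theorem ncard_biUnion_le_ncard_mul {ι α : Type*} {s : Set ι} (hs : s.Finite) {f : ι → Set α} {k : ℕ}
    (hf : ∀ i ∈ s, (f i).ncard ≤ k) : (⋃ i ∈ s, f i).ncard ≤ s.ncard * k := by
  lift s to Finset ι using hs
  rw [Set.ncard_coe_finset]
  exact (Finset.set_ncard_biUnion_le s f).trans (Finset.sum_le_card_nsmul s _ k hf)

variable {K : Type*} [Field K] {n : ℕ}

variable (K n) in
/-- The common vertex `(1 : 0 : … : 0)` of the cones defined by the polynomials that do not involve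
the first variable. -/
noncomputable def coneVertex : ℙ K (Fin (n + 1) → K) :=
  Projectivization.mk K (Pi.single 0 1) (Pi.single_ne_zero_iff.mpr one_ne_zero)

/-- The point `(t : w)` of the line joining `coneVertex` to the point `w` of the base of the cone.
For fixed `w` these are all the points of the line but the vertex, in a parametrisation that depends
on the chosen representative of `w`. -/
noncomputable def conePoint (w : ℙ K (Fin n → K)) (t : K) : ℙ K (Fin (n + 1) → K) :=
  Projectivization.mk K (Fin.cons t w.rep) fun h => w.rep_nonzero (congrArg Fin.tail h)

theorem eq_coneVertex_or_eq_conePoint (x : ℙ K (Fin (n + 1) → K)) :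
    x = coneVertex K n ∨ ∃ w t, x = conePoint w t := by
  induction x with
  | h v hv =>
    by_cases htail : Fin.tail v = 0
    · left
      refine (Projectivization.mk_eq_mk_iff' K _ _ _ _).mpr ⟨v 0, ?_⟩
      rw [← Fin.cons_self_tail v, htail]
      ext i
      cases i using Fin.cases <;> simp
    · right
      obtain ⟨a, ha⟩ := Projectivization.exists_smul_eq_mk_rep K _ htail
      refine ⟨Projectivization.mk K _ htail, a * v 0, ?_⟩
      refine ((Projectivization.mk_eq_mk_iff K _ _ _ _).mpr ⟨a, ?_⟩).symm
      rw [← ha]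
      ext i
      cases i using Fin.cases <;> simp [Fin.tail, Units.smul_def]

theorem conePoint_mem_rationalPoints_iff {F : MvPolynomial (Fin (n + 1)) K} {d : ℕ}
    (hF : F.IsHomogeneous d) (w : ℙ K (Fin n → K)) (t : K) :
    conePoint w t ∈ rationalPoints F ↔ eval (Fin.cons t w.rep) F = 0 :=
  mk_mem_rationalPoints_iff hF _ _

theorem ncard_eval_cons_eq_zero_le {F : MvPolynomial (Fin (n + 1)) K} {v : Fin n → K}
    (hv : eval v (finSuccEquiv K n F).leadingCoeff ≠ 0) :
    {t : K | eval (Fin.cons t v) F = 0}.ncard ≤ (finSuccEquiv K n F).natDegree := by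
  classical
  set f := (finSuccEquiv K n F).map (eval v)
  have hf : f ≠ 0 := fun h => hv <| by
    simpa [f] using congrArg (·.coeff (finSuccEquiv K n F).natDegree) h
  have hroots : {t : K | eval (Fin.cons t v) F = 0} = f.roots.toFinset := by
    ext t
    simp [f, eval_eq_eval_mv_eval', hf]
  rw [hroots, Set.ncard_coe_finset]
  exact (Multiset.toFinset_card_le _).trans ((Polynomial.card_roots' f).trans
    Polynomial.natDegree_map_le)

theorem ncard_cone_inter_le [Finite K] {h : MvPolynomial (Fin (n + 1)) K} {k : ℕ}
    (hh : h.IsHomogeneous k) {F : MvPolynomial (Fin (n + 1 + 1)) K} {d : ℕ}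
    (hF : F.IsHomogeneous d) :
    (rationalPoints (rename Fin.succ h) ∩ rationalPoints F).ncard ≤
      1 + (finSuccEquiv K _ F).natDegree * (rationalPoints h).ncard + Nat.card K *
        (rationalPoints h ∩ rationalPoints (finSuccEquiv K _ F).leadingCoeff).ncard := by
  set L := rationalPoints (finSuccEquiv K _ F).leadingCoeff
  let ruling (w : ℙ K (Fin (n + 1) → K)) : Set (ℙ K (Fin (n + 1 + 1) → K)) :=
    conePoint w '' {t | eval (Fin.cons t w.rep) F = 0}
  have hcover : rationalPoints (rename Fin.succ h) ∩ rationalPoints F ⊆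
      insert (coneVertex K (n + 1))
        ((⋃ w ∈ rationalPoints h \ L, ruling w) ∪ ⋃ w ∈ rationalPoints h ∩ L, ruling w) := by
    rintro x ⟨hxh, hxF⟩
    obtain rfl | ⟨w, t, rfl⟩ := eq_coneVertex_or_eq_conePoint x
    · exact Set.mem_insert _ _
    refine Set.mem_insert_of_mem _ ?_
    rw [← Set.biUnion_union, Set.sdiff_union_inter]
    rw [conePoint_mem_rationalPoints_iff hh.rename_isHomogeneous, eval_rename,
      Fin.cons_comp_succ] at hxh
    rw [conePoint_mem_rationalPoints_iff hF] at hxF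
    exact Set.mem_biUnion hxh (Set.mem_image_of_mem _ hxF)
  have hgeneric := ncard_biUnion_le_ncard_mul (Set.toFinite (rationalPoints h \ L)) (f := ruling)
    fun w hw => (Set.ncard_image_le (Set.toFinite _)).trans (ncard_eval_cons_eq_zero_le hw.2)
  have hspecial := ncard_biUnion_le_ncard_mul (Set.toFinite (rationalPoints h ∩ L)) (f := ruling)
    fun w _ => (Set.ncard_image_le (Set.toFinite _)).trans (Set.ncard_le_card _)
  have hdiff : (rationalPoints h \ L).ncard ≤ (rationalPoints h).ncard :=
    Set.ncard_le_ncard Set.sdiff_subset (Set.toFinite _)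
  calc _ ≤ _ := Set.ncard_le_ncard hcover (Set.toFinite _)
    _ ≤ _ := Set.ncard_insert_le _ _
    _ ≤ (rationalPoints h \ L).ncard * _ + (rationalPoints h ∩ L).ncard * Nat.card K + 1 := by
      gcongr
      exact (Set.ncard_union_le _ _).trans (add_le_add hgeneric hspecial)
    _ ≤ (rationalPoints h).ncard * _ + (rationalPoints h ∩ L).ncard * Nat.card K + 1 := by
      gcongr
    _ = _ := by ring

theorem natDegree_finSuccEquiv_le {R : Type*} [CommSemiring R] {F : MvPolynomial (Fin (n + 1)) R}
    {d : ℕ} (hF : F.IsHomogeneous d) : (finSuccEquiv R n F).natDegree ≤ d := by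
  rw [natDegree_finSuccEquiv]
  exact (degreeOf_le_totalDegree F 0).trans hF.totalDegree_le

theorem isHomogeneous_leadingCoeff_finSuccEquiv {R : Type*} [CommSemiring R]
    {F : MvPolynomial (Fin (n + 1)) R} {d : ℕ} (hF : F.IsHomogeneous d) :
    (finSuccEquiv R n F).leadingCoeff.IsHomogeneous (d - (finSuccEquiv R n F).natDegree) :=
  hF.finSuccEquiv_coeff_isHomogeneous _ _ (Nat.add_sub_cancel' (natDegree_finSuccEquiv_le hF))

end Cone

section CoordinateChange

theorem eval_bind₁_toMvPolynomial {R m n : Type*} [CommSemiring R] [Fintype n]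
    (P : Matrix m n R) (F : MvPolynomial m R) (v : n → R) :
    eval v (bind₁ P.toMvPolynomial F) = eval (P *ᵥ v) F := by
  have h := aeval_bind₁ (R := R) v P.toMvPolynomial F
  simp only [aeval_eq_eval, Matrix.toMvPolynomial_eval_eq_apply] at h
  exact h

theorem isHomogeneous_bind₁_toMvPolynomial {R m n : Type*} [CommSemiring R] [Fintype n]
    (P : Matrix m n R) {F : MvPolynomial m R} {d : ℕ} (hF : F.IsHomogeneous d) :
    (bind₁ P.toMvPolynomial F).IsHomogeneous d := by
  have h := hF.aeval P.toMvPolynomial P.toMvPolynomial_isHomogeneous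
  rwa [one_mul] at h

theorem bind₁_toMvPolynomial_ne_zero {R m : Type*} [CommRing R] [Fintype m] [DecidableEq m]
    {P : Matrix m m R} (hP : IsUnit P.det) {F : MvPolynomial m R} (hF : F ≠ 0) :
    bind₁ P.toMvPolynomial F ≠ 0 := by
  intro h
  have hcomp : bind₁ P⁻¹.toMvPolynomial (bind₁ P.toMvPolynomial F) = F := by
    rw [bind₁_bind₁]
    simp only [← Matrix.toMvPolynomial_mul, Matrix.mul_nonsing_inv P hP]
    simp only [Matrix.toMvPolynomial_one, bind₁_X_left, AlgHom.id_apply]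
  rw [h, map_zero] at hcomp
  exact hF hcomp.symm

theorem smul_mem_rationalPoints_iff {K : Type*} [Field K] {n : ℕ} {d : ℕ}
    {F : MvPolynomial (Fin (n + 1)) K} (hF : F.IsHomogeneous d)
    (g : Matrix.SpecialLinearGroup (Fin (n + 1)) K)
    (x : ℙ K (Fin (n + 1) → K)) :
    g • x ∈ rationalPoints F ↔ x ∈ rationalPoints (bind₁ g.1.toMvPolynomial F) := by
  induction x with
  | h v hv =>
    rw [Projectivization.smul_mk, mk_mem_rationalPoints_iff hF,
      mk_mem_rationalPoints_iff (isHomogeneous_bind₁_toMvPolynomial g.1 hF),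
      eval_bind₁_toMvPolynomial, Matrix.SpecialLinearGroup.smul_def,
      Matrix.smul_eq_mulVec]

theorem ncard_eq_ncard_of_smul_mem_iff {G α : Type*} [Group G] [MulAction G α] (g : G)
    {s t : Set α} (h : ∀ x, g • x ∈ s ↔ x ∈ t) : s.ncard = t.ncard := by
  rw [← show (g • ·) ⁻¹' s = t from Set.ext h, Set.ncard_preimage_of_injective_subset_range
    (MulAction.injective g) (by simp [(MulAction.surjective g).range_eq])]

end CoordinateChange

section NormalForm

variable {K : Type*} [Field K] {n q : ℕ}

theorem eval_mulVec_hermitianForm {φ : K →+* K} (hφ : ∀ a, φ a = a ^ q)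
    (H P : Matrix (Fin (n + 1)) (Fin (n + 1)) K) (v : Fin (n + 1) → K) :
    eval (P *ᵥ v) (hermitianForm q H) =
      eval v (hermitianForm q (Pᵀ * H * P.map φ)) := by
  have hpow : (fun j => (P *ᵥ v) j ^ q) = P.map φ *ᵥ fun j => v j ^ q := by
    funext j
    rw [← hφ, RingHom.map_mulVec]
    simp only [Function.comp_def, hφ]
  rw [eval_hermitianForm, eval_hermitianForm, hpow, ← Matrix.vecMul_transpose,
    ← Matrix.dotProduct_mulVec, Matrix.mulVec_mulVec, Matrix.mulVec_mulVec]

theorem smul_mem_rationalPoints_hermitianForm_iff {φ : K →+* K} (hφ : ∀ a, φ a = a ^ q)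
    (H : Matrix (Fin (n + 1)) (Fin (n + 1)) K) (g : Matrix.SpecialLinearGroup (Fin (n + 1)) K)
    (x : ℙ K (Fin (n + 1) → K)) :
    g • x ∈ rationalPoints (hermitianForm q H) ↔
      x ∈ rationalPoints (hermitianForm q (g.1ᵀ * H * g.1.map φ)) := by
  induction x with
  | h v hv =>
    rw [Projectivization.smul_mk, mk_mem_rationalPoints_iff (hermitianForm_isHomogeneous _ _),
      mk_mem_rationalPoints_iff (hermitianForm_isHomogeneous _ _),
      Matrix.SpecialLinearGroup.smul_def, Matrix.smul_eq_mulVec, eval_mulVec_hermitianForm hφ]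

theorem hermitianForm_eq_rename_succ {N : Matrix (Fin (n + 1 + 1)) (Fin (n + 1 + 1)) K}
    (hrow : ∀ j, N 0 j = 0) (hcol : ∀ i, N i 0 = 0) :
    hermitianForm q N = rename Fin.succ (hermitianForm q (N.submatrix Fin.succ Fin.succ)) := by
  simp [hermitianForm, Fin.sum_univ_succ (n := n + 1), hrow, hcol]

theorem rank_le_rank_submatrix_succ {N : Matrix (Fin (n + 1)) (Fin (n + 1)) K}
    (hrow : ∀ j, N 0 j = 0) (hcol : ∀ i, N i 0 = 0) :
    N.rank ≤ (N.submatrix Fin.succ Fin.succ).rank := by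
  set E : Matrix (Fin (n + 1)) (Fin n) K := (1 : Matrix _ _ K).submatrix id Fin.succ
  have hE : N = E * (N.submatrix Fin.succ Fin.succ * Eᵀ) := by
    ext i j
    cases i using Fin.cases with
    | zero => simp [Matrix.mul_apply, E, hrow, Matrix.one_apply, (Fin.succ_ne_zero _).symm]
    | succ i =>
      cases j using Fin.cases with
      | zero => simp [Matrix.mul_apply, E, hcol, Matrix.one_apply]
      | succ j => simp [Matrix.mul_apply, E, Matrix.one_apply, Fin.succ_inj]
  conv_lhs => rw [hE]
  exact (Matrix.rank_mul_le_right _ _).trans (Matrix.rank_mul_le_left _ _)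

theorem det_ne_zero_of_card_le_rank {ι : Type*} [Fintype ι] [DecidableEq ι] {M : Matrix ι ι K}
    (h : Fintype.card ι ≤ M.rank) : M.det ≠ 0 := by
  have hrow := M.rank_eq_finrank_span_row
  rw [← isUnit_iff_ne_zero, ← Matrix.isUnit_iff_isUnit_det,
    ← Matrix.linearIndependent_rows_iff_isUnit, linearIndependent_iff_card_le_finrank_span]
  exact h.trans hrow.le

theorem transpose_hermitian_congr {ι κ : Type*} [Fintype ι] {φ : K →+* K}
    (hφφ : ∀ a, φ (φ a) = a) {H : Matrix ι ι K} (hH : Hᵀ = H.map φ) (P : Matrix ι κ K) :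
    (Pᵀ * H * P.map φ)ᵀ = (Pᵀ * H * P.map φ).map φ := by
  have hP : (P.map φ).map φ = P := by
    ext i j
    simp [hφφ]
  simp only [Matrix.transpose_mul, Matrix.map_mul, hH, hP, Matrix.transpose_transpose,
    Matrix.transpose_map, Matrix.mul_assoc]

theorem transpose_mul_mul_apply_eq_zero {ι κ μ ν : Type*} [Fintype ι] [Fintype κ] [Fintype μ]
    [DecidableEq μ] {P : Matrix ι μ K} {H : Matrix ι κ K} {i : μ}
    (hP : (P *ᵥ Pi.single i 1) ᵥ* H = 0) (Q : Matrix κ ν K) (j : ν) :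
    (Pᵀ * H * Q) i j = 0 := by
  rw [Matrix.mulVec_single_one] at hP
  change (P.col i ᵥ* H ᵥ* Q) j = 0
  rw [hP, Matrix.zero_vecMul, Pi.zero_apply]

theorem exists_vertex_vecMul_eq_zero {H : Matrix (Fin (n + 1)) (Fin (n + 1)) K}
    (hH : H.det = 0) : ∃ g : Matrix.SpecialLinearGroup (Fin (n + 1)) K,
      (g.1 *ᵥ Pi.single 0 1) ᵥ* H = 0 := by
  obtain ⟨p, hp0, hp⟩ := Matrix.exists_vecMul_eq_zero_iff.mpr hH
  obtain ⟨g, hg⟩ := MulAction.exists_smul_eq (Matrix.SpecialLinearGroup (Fin (n + 1)) K)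
    (coneVertex K n) (Projectivization.mk K p hp0)
  obtain ⟨a, ha⟩ := (Projectivization.mk_eq_mk_iff' K _ _ _ _).mp hg
  have hcol : g.1 *ᵥ Pi.single 0 1 = a • p := ha.symm
  exact ⟨g, by rw [hcol, Matrix.smul_vecMul, hp, smul_zero]⟩

theorem exists_cone_coordinates {φ : K →+* K} (hφ : ∀ a, φ a = a ^ q) (hφφ : ∀ a, φ (φ a) = a)
    {H : Matrix (Fin (n + 1 + 1)) (Fin (n + 1 + 1)) K} (hH : Hᵀ = H.map φ)
    (hrank : H.rank = n + 1) :
    ∃ (g : Matrix.SpecialLinearGroup (Fin (n + 1 + 1)) K)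
      (M : Matrix (Fin (n + 1)) (Fin (n + 1)) K), M.det ≠ 0 ∧ ∀ x,
        g • x ∈ rationalPoints (hermitianForm q H) ↔
          x ∈ rationalPoints (rename Fin.succ (hermitianForm q M)) := by
  have hdet : H.det = 0 := by
    by_contra h
    have := Matrix.rank_of_det_ne_zero h
    simp [hrank] at this
  obtain ⟨g, hg⟩ := exists_vertex_vecMul_eq_zero hdet
  set N := g.1ᵀ * H * g.1.map φ
  have hrow (j) : N 0 j = 0 := transpose_mul_mul_apply_eq_zero hg _ j
  have hcol (i) : N i 0 = 0 := by
    have h : N i 0 = φ (N 0 i) := congrFun₂ (transpose_hermitian_congr hφφ hH g.1) 0 i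
    rw [h, hrow, map_zero]
  have hrankN : N.rank = n + 1 := by
    have hgφ : (g.1.map φ).det ≠ 0 := by
      rw [← RingHom.mapMatrix_apply, ← RingHom.map_det, g.det_coe, map_one]
      exact one_ne_zero
    rw [Matrix.rank_mul_eq_left_of_det_ne_zero _ _ hgφ,
      Matrix.rank_mul_eq_right_of_det_ne_zero _ _ (by simp), hrank]
  refine ⟨g, N.submatrix Fin.succ Fin.succ, det_ne_zero_of_card_le_rank ?_, fun x => ?_⟩
  · rw [Fintype.card_fin]
    exact hrankN.ge.trans (rank_le_rank_submatrix_succ hrow hcol)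
  · rw [← hermitianForm_eq_rename_succ hrow hcol]
    exact smul_mem_rationalPoints_hermitianForm_iff hφ H g x

end NormalForm

section Surface

variable {K : Type*} [Field K]

theorem exists_involutive_frobenius [Finite K] {q : ℕ} (hK : Nat.card K = q ^ 2) :
    (q : K) = 0 ∧ ∃ φ : K →+* K, (∀ a, φ a = a ^ q) ∧ ∀ a, φ (φ a) = a := by
  have := Fintype.ofFinite K
  rw [Nat.card_eq_fintype_card] at hK
  obtain ⟨p, hp⟩ := CharP.exists K
  obtain ⟨n, hprime, hn⟩ := FiniteField.card K p
  have := Fact.mk hprime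
  obtain ⟨k, -, rfl⟩ := (Nat.dvd_prime_pow hprime).mp
    (hn ▸ hK ▸ Dvd.intro_left q (sq q).symm : q ∣ p ^ (n : ℕ))
  refine ⟨?_, iterateFrobenius K p k, iterateFrobenius_def p k, fun a => ?_⟩
  · have h := Nat.cast_card_eq_zero K
    rw [hK, Nat.cast_pow] at h
    exact pow_eq_zero_iff two_ne_zero |>.mp h
  · rw [iterateFrobenius_def, iterateFrobenius_def, ← pow_mul, ← sq, ← hK, FiniteField.pow_card]

theorem ncard_hermitian_cone_inter_le [Finite K] {q d : ℕ} (hK : Nat.card K = q ^ 2)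
    (hq : (q : K) = 0) {M : Matrix (Fin (2 + 1)) (Fin (2 + 1)) K} (hM : M.det ≠ 0)
    {F : MvPolynomial (Fin (2 + 1 + 1)) K} (hF : F ≠ 0) (hFd : F.IsHomogeneous d) (hd : d ≤ q) :
    (rationalPoints (rename Fin.succ (hermitianForm q M)) ∩ rationalPoints F).ncard ≤
      1 + q ^ 2 * (d * (q + 1)) := by
  have hlead : (finSuccEquiv K _ F).leadingCoeff ≠ 0 := by simpa using hF
  have hbase := ncard_hermitian_inter_le hq hM (isHomogeneous_leadingCoeff_finSuccEquiv hFd) hlead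
    ((Nat.sub_le _ _).trans hd)
  obtain ⟨e, he⟩ := Nat.exists_eq_add_of_le (natDegree_finSuccEquiv_le hFd)
  set i := (finSuccEquiv K _ F).natDegree
  calc _ ≤ _ := ncard_cone_inter_le (hermitianForm_isHomogeneous q M) hFd
    _ ≤ 1 + i * (q ^ 2 * (q + 1)) + q ^ 2 * ((d - i) * (q + 1)) := by
      rw [hK]
      gcongr
      exact ncard_hermitian_curve_le hK hq hM
    _ = 1 + q ^ 2 * (d * (q + 1)) := by
      rw [he, Nat.add_sub_cancel_left]
      ring

end Surface

end HermitianCone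

open HermitianCone in
theorem mainTheorem4 {K : Type*} [Field K] [Fintype K] (q d : ℕ)
    (hK : Fintype.card K = q ^ 2) (hd : d ≤ q)
    (H : Matrix (Fin (3 + 1)) (Fin (3 + 1)) K)
    (hH : HermitianCone.IsHermitianMatrix q H) (hrank : H.rank = 3)
    (F : MvPolynomial (Fin (3 + 1)) K) (hF : F ≠ 0) (hFd : F.IsHomogeneous d) :
    (HermitianCone.rationalPoints (HermitianCone.hermitianForm q H) ∩
        HermitianCone.rationalPoints F).ncard ≤ 1 + q ^ 2 * (d * (q + 1)) := by
  rw [← Nat.card_eq_fintype_card] at hK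
  obtain ⟨hq, φ, hφ, hφφ⟩ := exists_involutive_frobenius hK
  have hHφ : H.transpose = H.map φ := hH.2.trans (congrArg H.map (funext fun a => (hφ a).symm))
  obtain ⟨g, M, hM, hcone⟩ := exists_cone_coordinates hφ hφφ hHφ hrank
  have hncard : (rationalPoints (hermitianForm q H) ∩ rationalPoints F).ncard =
      (rationalPoints (MvPolynomial.rename Fin.succ (hermitianForm q M)) ∩
        rationalPoints (MvPolynomial.bind₁ g.1.toMvPolynomial F)).ncard :=
    ncard_eq_ncard_of_smul_mem_iff g fun x =>
      and_congr (hcone x) (smul_mem_rationalPoints_iff hFd g x)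
  rw [hncard]
  exact ncard_hermitian_cone_inter_le hK hq hM
    (bind₁_toMvPolynomial_ne_zero (by simp) hF) (isHomogeneous_bind₁_toMvPolynomial g.1 hFd) hd
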